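/- Let $G$ be a profinite group (a compact, totally disconnected topological group). A permutable complement of a subgroup $H \le G$ is a subgroup $K \le G$ with $G = HK$ and $H \cap K = 1$. Assume that $G$ is a profinite-$C$ group, that is, every closed subgroup of $G$ has a closed permutable complement in $G$. Then the following are equivalent: (i) $G$ is a $C$-group, that is, every subgroup of $G$ (closed or not) has a permutable complement in $G$; (ii) $G$ is torsion (every element of $G$ has finite order) and $|G : Z(G)\,\overline{G'}| < \infty$, where $Z(G)$ is the center of $G$ and $\overline{G'}$ is the topological closure of the derived subgroup $G'$ of $G$. In particular, if the profinite-$C$ group $G$ is abelian, then $G$ is a $C$-group if and only if it is torsion. -/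

import Mathlib

open scoped Pointwise

/-- `K` is a permutable complement of `H` in `G`: `G = HK` and `H ∩ K = 1`. -/
def IsPermutableComplement {G : Type*} [Group G] (H K : Subgroup G) : Prop :=
  (H : Set G) * (K : Set G) = Set.univ ∧ H ⊓ K = ⊥

/-- An (abstract) group is a `C`-group if every subgroup has a permutable complement. -/
def IsCGroup (G : Type*) [Group G] : Prop :=
  ∀ H : Subgroup G, ∃ K : Subgroup G, IsPermutableComplement H K

/-- The condition that every closed subgroup has a closed permutable complement; a profinite group
with this property is a profinite-`C` group. -/
def IsProfiniteCGroup (G : Type*) [Group G] [TopologicalSpace G] : Prop :=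
  ∀ H : Subgroup G, IsClosed (H : Set G) →
    ∃ K : Subgroup G, IsClosed (K : Set G) ∧ IsPermutableComplement H K

/-!
Write `A` for the closure of `G'`. Three facts carry the proof.

* `A` is abelian (`IsProfiniteCGroup.closure_commutator_comm`), because a finite group with all
  subgroups complemented is metabelian (`IsCGroup.commutator_commutator_eq_bot`). Such a finite
  group has a normal subgroup `N` of prime order. If `K` is a complement of `N` and `D` is the
  centralizer of `N` in `K`, then `G' ≤ C(N) = N × D`, so `G'' ≤ D`, while `G'' ≤ N` by induction.
  As `A` is closed it has a closed complement `B`, which is abelian since `G' ≤ A`.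
* If `M` is an abelian normal torsion subgroup all of whose subgroups are complemented in `G`, then
  `M` is generated by normal subgroups of `G` of prime order (`le_primeSocle_of_complemented`): `M`
  is a semisimple `G`-module whose simple submodules have prime order.
* Conversely, if `A` is generated by normal subgroups of `G` of prime order and has a complement
  that is a `C`-group, then `G` is a `C`-group (`isCGroup_of_le_primeSocle`).

If `G` is a `C`-group, it is torsion, and by the second fact every element of `A` lies in a product
of finitely many normal subgroups of prime order, so its conjugacy class is finite. A Baire category
argument (`finiteIndex_centralizer_of_le_finiteClassSubgroup`) makes this uniform: `C(A)` has finite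
index. Finally `C(A) ≤ A Z(G)`, because `A` and `B` are abelian.

If `G` is torsion and `A Z(G)` has finite index, every `a ∈ A` has a finite conjugacy class, so its
normal closure is finite. The subgroups of this normal closure are closed, hence complemented, and
the second fact shows that `A` is generated by normal subgroups of prime order. The same argument in
the abelian group `B` shows that `B` is a `C`-group, and the third fact applies.
-/

open scoped commutatorElement

/-! ### Permutable complements -/

namespace IsPermutableComplement

variable {G : Type*} [Group G] {H K L M N : Subgroup G}

theorem exists_mul_eq (h : IsPermutableComplement H K) (g : G) : ∃ x ∈ H, ∃ y ∈ K, x * y = g :=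
  Set.mem_mul.1 (h.1 ▸ Set.mem_univ g)

theorem eq_one (h : IsPermutableComplement H K) {x : G} (hx : x ∈ H) (hy : x ∈ K) : x = 1 :=
  Subgroup.mem_bot.1 (h.2 ▸ Subgroup.mem_inf.2 ⟨hx, hy⟩)

theorem of_forall (h₁ : ∀ g, ∃ x ∈ H, ∃ y ∈ K, x * y = g) (h₂ : ∀ x ∈ H, x ∈ K → x = 1) :
    IsPermutableComplement H K :=
  ⟨Set.eq_univ_of_forall fun g => Set.mem_mul.2 (h₁ g),
    (Subgroup.eq_bot_iff_forall _).2 fun x hx => h₂ x hx.1 hx.2⟩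

theorem isComplement' (h : IsPermutableComplement H K) : H.IsComplement' K :=
  Subgroup.isComplement'_of_disjoint_and_mul_eq_univ (disjoint_iff.2 h.2) h.1

/-- Dedekind's modular law: complements can be cut down to a subgroup. -/
theorem exists_mul_eq_of_le (h : IsPermutableComplement H K) (hHL : H ≤ L) {g : G} (hg : g ∈ L) :
    ∃ x ∈ H, ∃ y ∈ K ⊓ L, x * y = g := by
  obtain ⟨x, hx, y, hy, rfl⟩ := h.exists_mul_eq g
  exact ⟨x, hx, y, ⟨hy, (L.mul_mem_cancel_left (hHL hx)).1 hg⟩, rfl⟩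

theorem subgroupOf (h : IsPermutableComplement H K) (hHL : H ≤ L) :
    IsPermutableComplement (H.subgroupOf L) (K.subgroupOf L) := by
  refine of_forall (fun g => ?_) fun x hx hy => Subtype.ext (h.eq_one hx hy)
  obtain ⟨x, hx, y, hy, hxy⟩ := h.exists_mul_eq_of_le hHL g.2
  exact ⟨⟨x, hHL hx⟩, hx, ⟨y, hy.2⟩, hy.1, Subtype.ext hxy⟩

theorem map_mk' [N.Normal] {H : Subgroup (G ⧸ N)}
    (h : IsPermutableComplement (H.comap (QuotientGroup.mk' N)) K) :
    IsPermutableComplement H (K.map (QuotientGroup.mk' N)) := by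
  refine of_forall (fun g => ?_) ?_
  · obtain ⟨g, rfl⟩ := QuotientGroup.mk'_surjective N g
    obtain ⟨x, hx, y, hy, rfl⟩ := h.exists_mul_eq g
    exact ⟨_, hx, _, Subgroup.mem_map_of_mem _ hy, (map_mul _ _ _).symm⟩
  · rintro _ hx ⟨y, hy, rfl⟩
    rw [h.eq_one hx hy, map_one]

/-- If `H` lies in an abelian normal subgroup `M`, the trace on `M` of a complement of `H` is
normalized by `M` and by the complement, hence by the whole group. -/
theorem normal_inf (h : IsPermutableComplement H K) [hMn : M.Normal]
    (hM : ∀ a ∈ M, ∀ b ∈ M, a * b = b * a) (hHM : H ≤ M) : (K ⊓ M).Normal where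
  conj_mem k hk g := by
    obtain ⟨x, hx, y, hy, rfl⟩ := h.exists_mul_eq g
    have hc : y * k * y⁻¹ ∈ K ⊓ M :=
      ⟨K.mul_mem (K.mul_mem hy hk.1) (K.inv_mem hy), hMn.conj_mem k hk.2 y⟩
    have he : x * y * k * (x * y)⁻¹ = x * (y * k * y⁻¹) * x⁻¹ := by group
    rwa [he, hM x (hHM hx) _ hc.2, mul_inv_cancel_right]

end IsPermutableComplement

namespace IsCGroup

variable {G : Type*} [Group G]

theorem subgroup (h : IsCGroup G) (L : Subgroup G) : IsCGroup L := fun H => by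
  obtain ⟨K, hK⟩ := h (H.map L.subtype)
  have := hK.subgroupOf (Subgroup.map_subtype_le H)
  rw [← Subgroup.comap_subtype, Subgroup.comap_map_eq_self_of_injective L.subtype_injective] at this
  exact ⟨_, this⟩

theorem quotient (h : IsCGroup G) (N : Subgroup G) [N.Normal] : IsCGroup (G ⧸ N) := fun H =>
  let ⟨_, hK⟩ := h (H.comap (QuotientGroup.mk' N))
  ⟨_, hK.map_mk'⟩

/-- If `K` complements `⟨x ^ 2⟩`, then `K` contains an odd power of `x`, whose square lies in
`K ∩ ⟨x ^ 2⟩ = 1`. -/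
theorem isMulTorsion (h : IsCGroup G) : IsMulTorsion G := fun x => by
  obtain ⟨K, hK⟩ := h (Subgroup.zpowers (x ^ 2))
  obtain ⟨_, ⟨n, rfl⟩, y, hy, hxy⟩ := hK.exists_mul_eq x
  have hxy' : x ^ (2 * n) * y = x := by
    rw [zpow_mul]
    exact_mod_cast hxy
  have hy' : y = x ^ (1 - 2 * n) := by
    rw [sub_eq_neg_add, zpow_add, zpow_neg, zpow_one, eq_inv_mul_iff_mul_eq, hxy']
  have hy2 : y ^ 2 = 1 := by
    refine hK.eq_one ⟨1 - 2 * n, ?_⟩ (K.pow_mem hy 2)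
    change (x ^ 2) ^ (1 - 2 * n) = y ^ 2
    rw [hy', ← zpow_natCast, ← zpow_natCast, ← zpow_mul, ← zpow_mul, mul_comm]
  refine isOfFinOrder_iff_zpow_eq_one.2 ⟨(1 - 2 * n) * 2, by omega, ?_⟩
  rw [zpow_mul, ← hy']
  exact_mod_cast hy2

end IsCGroup

/-! ### The socle of an abelian normal subgroup -/

/-- The subgroup generated by the normal subgroups of `G` that have prime order and lie in `M`. -/
def primeSocle {G : Type*} [Group G] (M : Subgroup G) : Subgroup G :=
  sSup {P | P.Normal ∧ P ≤ M ∧ (Nat.card P).Prime}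

section Socle

variable {G : Type*} [Group G] {M A : Subgroup G}

theorem le_primeSocle {P : Subgroup G} (hn : P.Normal) (hP : P ≤ M) (hp : (Nat.card P).Prime) :
    P ≤ primeSocle M :=
  le_sSup ⟨hn, hP, hp⟩

theorem primeSocle_le : primeSocle M ≤ M :=
  sSup_le fun _ h => h.2.1

theorem primeSocle_mono (h : M ≤ A) : primeSocle M ≤ primeSocle A :=
  sSup_le_sSup fun _ hP => ⟨hP.1, hP.2.1.trans h, hP.2.2⟩

/-- If the socle `S` were proper, its complement would meet `M` in a nontrivial normal subgroup `R`.
For `y ∈ R` of prime order, a complement of `⟨y⟩` meets `R` in a normal subgroup `L` with `R / L` of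
prime order, and a complement of `L` then meets `R` in a normal subgroup of prime order outside
`S`. -/
theorem le_primeSocle_of_complemented [M.Normal] (hM : ∀ a ∈ M, ∀ b ∈ M, a * b = b * a)
    (ht : ∀ a ∈ M, IsOfFinOrder a) (hc : ∀ H ≤ M, ∃ K, IsPermutableComplement H K) :
    M ≤ primeSocle M := by
  by_contra hS
  obtain ⟨m, hm, hmS⟩ := Set.not_subset.1 hS
  obtain ⟨K, hK⟩ := hc _ primeSocle_le
  have hR : (K ⊓ M).Normal := hK.normal_inf hM primeSocle_le
  obtain ⟨s, hs, x, hx, hsx⟩ := hK.exists_mul_eq_of_le primeSocle_le hm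
  have hx1 : x ≠ 1 := by
    rintro rfl
    exact hmS (by rw [← hsx, mul_one]; exact hs)
  have hx0 : orderOf x ≠ 0 := (ht x hx.2).orderOf_pos.ne'
  obtain ⟨p, hp, hpx⟩ := Nat.exists_prime_and_dvd (mt orderOf_eq_one_iff.1 hx1)
  set y := x ^ (orderOf x / p) with hy
  have hyp : orderOf y = p := orderOf_pow_orderOf_div hx0 hpx
  have hyR : Subgroup.zpowers y ≤ K ⊓ M :=
    (Subgroup.zpowers_le).2 ((K ⊓ M).pow_mem hx _)
  obtain ⟨K₁, hK₁⟩ := hc _ (hyR.trans inf_le_right)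
  have hK₁n := hK₁.normal_inf hM (hyR.trans inf_le_right)
  have hLM : K₁ ⊓ (K ⊓ M) ≤ M := inf_le_right.trans inf_le_right
  obtain ⟨K₂, hK₂⟩ := hc _ hLM
  have hK₂n := hK₂.normal_inf hM hLM
  have hPn : (K₂ ⊓ (K ⊓ M)).Normal := by
    have : K₂ ⊓ (K ⊓ M) = K₂ ⊓ M ⊓ (K ⊓ M) := by
      rw [inf_assoc, inf_eq_right.2 (inf_le_right : K ⊓ M ≤ M)]
    rw [this]
    infer_instance
  have hcard : Nat.card ↥(K₂ ⊓ (K ⊓ M)) = p := by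
    have h₁ := (hK₁.subgroupOf hyR).isComplement'.index_eq_card
    have h₂ := (hK₂.subgroupOf (inf_le_right : K₁ ⊓ (K ⊓ M) ≤ _)).isComplement'.symm.index_eq_card
    rw [Subgroup.inf_subgroupOf_right, h₁,
      Nat.card_congr (Subgroup.subgroupOfEquivOfLe hyR).toEquiv, Nat.card_zpowers, hyp] at h₂
    rw [h₂, ← Subgroup.inf_subgroupOf_right,
      Nat.card_congr (Subgroup.subgroupOfEquivOfLe inf_le_right).toEquiv]
  have hPS := le_primeSocle hPn (inf_le_right.trans inf_le_right) (hcard.symm ▸ hp)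
  have hbot : K₂ ⊓ (K ⊓ M) = ⊥ :=
    (Subgroup.eq_bot_iff_forall _).2 fun z hz => hK.eq_one (hPS hz) hz.2.1
  rw [hbot, Subgroup.card_bot] at hcard
  exact hp.one_lt.ne hcard

/-- A maximal normal subgroup `N ≤ A` of `G` meeting `H` trivially satisfies `A ≤ HN`: otherwise
some normal subgroup of prime order in `A` is not contained in `(H ∩ A)N`, and could be added to
`N`. -/
theorem exists_normal_complement_of_le_primeSocle (hA : A ≤ primeSocle A) (H : Subgroup G) :
    ∃ N : Subgroup G, N.Normal ∧ N ≤ A ∧ (∀ x ∈ H, x ∈ N → x = 1) ∧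
      ∀ a ∈ A, ∃ x ∈ H, ∃ y ∈ N, x * y = a := by
  obtain ⟨N, -, hN⟩ := zorn_le_nonempty₀
    {N : Subgroup G | N.Normal ∧ N ≤ A ∧ ∀ x ∈ H, x ∈ N → x = 1} (fun c hc hchain N₀ hN₀ => by
      have hmem {x : G} : x ∈ sSup c ↔ ∃ N ∈ c, x ∈ N :=
        Subgroup.mem_sSup_of_directedOn ⟨N₀, hN₀⟩ hchain.directedOn
      refine ⟨sSup c, ⟨⟨fun n hn g => ?_⟩, sSup_le fun N hN => (hc hN).2.1, fun x hx hxc => ?_⟩,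
        fun N hN => le_sSup hN⟩
      · obtain ⟨N, hN, hn⟩ := hmem.1 hn
        exact hmem.2 ⟨N, hN, (hc hN).1.conj_mem n hn g⟩
      · obtain ⟨N, hN, hn⟩ := hmem.1 hxc
        exact (hc hN).2.2 x hx hn) ⊥ ⟨inferInstance, bot_le, fun x _ hx => hx⟩
  obtain ⟨hNn, hNA, hNH⟩ := hN.prop
  refine ⟨N, hNn, hNA, hNH, ?_⟩
  suffices h : A ≤ H ⊓ A ⊔ N by
    intro a ha
    obtain ⟨x, hx, y, hy, hxy⟩ := Subgroup.mem_sup_of_normal_right.1 (h ha)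
    exact ⟨x, hx.1, y, hy, hxy⟩
  refine hA.trans (sSup_le ?_)
  rintro P ⟨hPn, hPA, hp⟩
  by_contra hP
  have hdisj : ∀ z ∈ P, z ∈ H ⊓ A ⊔ N → z = 1 := by
    intro z hz hzX
    have := Fact.mk hp
    rcases Subgroup.eq_bot_or_eq_top_of_prime_card ((H ⊓ A ⊔ N).subgroupOf P) with h | h
    · exact congrArg Subtype.val
        (show (⟨z, hz⟩ : P) = 1 from Subgroup.mem_bot.1 (h ▸ Subgroup.mem_subgroupOf.2 hzX))
    · exact absurd (Subgroup.subgroupOf_eq_top.1 h) hP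
  refine hP ((le_sup_right.trans (hN.le_of_ge (y := N ⊔ P)
    ⟨inferInstance, sup_le hNA hPA, fun x hx hxN => ?_⟩ le_sup_left)).trans le_sup_right)
  obtain ⟨n, hn, z, hz, rfl⟩ := Subgroup.mem_sup_of_normal_right.1 hxN
  have hzX : n⁻¹ * (n * z) ∈ H ⊓ A ⊔ N :=
    mul_mem (inv_mem (Subgroup.mem_sup_right hn))
      (Subgroup.mem_sup_left ⟨hx, A.mul_mem (hNA hn) (hPA hz)⟩)
  rw [inv_mul_cancel_left] at hzX
  obtain rfl := hdisj z hz hzX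
  rw [mul_one] at hx ⊢
  exact hNH n hx hn

/-- For `H ≤ G` let `N ≤ A` be normal with `A ≤ HN` and `H ∩ N = 1`, and let `B₁` be a complement of
`B ∩ HN` in `B`. Then `N B₁` is a complement of `H`. -/
theorem isCGroup_of_le_primeSocle (hA : A ≤ primeSocle A) {B : Subgroup G}
    (hAB : IsPermutableComplement A B) (hB : IsCGroup B) : IsCGroup G := fun H => by
  obtain ⟨N, hNn, hNA, hNH, hN⟩ := exists_normal_complement_of_le_primeSocle hA H
  obtain ⟨B₁, hB₁⟩ := hB ((H ⊔ N).subgroupOf B)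
  refine ⟨N ⊔ B₁.map B.subtype, .of_forall (fun g => ?_) fun x hx hxN => ?_⟩
  · obtain ⟨a, ha, b, hb, rfl⟩ := hAB.exists_mul_eq g
    obtain ⟨x, hx, y, hy, rfl⟩ := hN a ha
    obtain ⟨c, hc, d, hd, hcd⟩ := hB₁.exists_mul_eq ⟨b, hb⟩
    obtain ⟨x', hx', y', hy', hxy'⟩ :=
      Subgroup.mem_sup_of_normal_right.1 (Subgroup.mem_subgroupOf.1 hc)
    have hb' : x' * y' * d = b := by
      rw [hxy']
      exact congrArg Subtype.val hcd
    -- move the factor `y` of `N` past `x'`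
    refine ⟨x * x', H.mul_mem hx hx', x'⁻¹ * y * x' * (y' * d),
      mul_mem (Subgroup.mem_sup_left ?_) (mul_mem (Subgroup.mem_sup_left hy')
        (Subgroup.mem_sup_right (Subgroup.mem_map_of_mem _ hd))), ?_⟩
    · simpa using hNn.conj_mem y hy x'⁻¹
    · rw [← hb']
      group
  · obtain ⟨n, hn, _, ⟨b, hb, rfl⟩, rfl⟩ := Subgroup.mem_sup_of_normal_left.1 hxN
    have hb1 : b = 1 := hB₁.eq_one (Subgroup.mem_subgroupOf.2 (by
      have := mul_mem (inv_mem (Subgroup.mem_sup_right hn : n ∈ H ⊔ N))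
        (Subgroup.mem_sup_left hx)
      rwa [inv_mul_cancel_left] at this)) hb
    subst hb1
    simp only [map_one, mul_one] at hx ⊢
    exact hNH n hx hn

theorem isCGroup_of_top_le_primeSocle (h : (⊤ : Subgroup G) ≤ primeSocle ⊤) : IsCGroup G :=
  fun H => by
    obtain ⟨N, -, -, hNH, hN⟩ := exists_normal_complement_of_le_primeSocle h H
    exact ⟨N, .of_forall (fun g => hN g trivial) hNH⟩

end Socle

/-! ### Finite groups with complemented subgroups are metabelian -/

theorem commutator_le_centralizer_of_prime_card {G : Type*} [Group G] {N : Subgroup G} [N.Normal]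
    (hp : (Nat.card N).Prime) : commutator G ≤ Subgroup.centralizer N := by
  have := Fact.mk hp
  have hN : IsCyclic N := isCyclic_of_prime_card rfl
  let e := IsCyclic.mulAutMulEquiv N
  intro g hg
  have h : e (MulAut.conjNormal g) = 1 :=
    Abelianization.commutator_subset_ker (e.toMonoidHom.comp MulAut.conjNormal) hg
  refine Subgroup.mem_centralizer_iff.2 fun n hn => ?_
  have hgn : g * n * g⁻¹ = n := by
    rw [← MulAut.conjNormal_apply g (⟨n, hn⟩ : N), (MulEquiv.map_eq_one_iff e).1 h,
      MulAut.one_apply]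
  exact (mul_inv_eq_iff_eq_mul.1 hgn).symm

/-- Let `N` be a normal subgroup of prime order with complement `K`, and let `D` be the centralizer
of `N` in `K`. Since `G' ≤ C(N) = N × D`, the second derived subgroup lies in `D`; if `G / N` is
metabelian, it also lies in `N`. -/
theorem commutator_commutator_eq_bot_of_quotient {G : Type*} [Group G] {N K : Subgroup G} [N.Normal]
    (hp : (Nat.card N).Prime) (hK : IsPermutableComplement N K)
    (h : ⁅commutator (G ⧸ N), commutator (G ⧸ N)⁆ = ⊥) : ⁅commutator G, commutator G⁆ = ⊥ := by
  have hmap : (commutator G).map (QuotientGroup.mk' N) = commutator (G ⧸ N) := by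
    rw [commutator_def, commutator_def, Subgroup.map_commutator,
      Subgroup.map_top_of_surjective _ (QuotientGroup.mk'_surjective N)]
  have hN : ⁅commutator G, commutator G⁆ ≤ N := by
    rw [← QuotientGroup.ker_mk' N, ← Subgroup.map_eq_bot_iff, Subgroup.map_commutator, hmap, h]
  have hC := commutator_le_centralizer_of_prime_card hp
  have hNC : N ≤ Subgroup.centralizer N := by
    have := Fact.mk hp
    have hN : IsCyclic N := isCyclic_of_prime_card rfl
    exact fun x hx => Subgroup.mem_centralizer_iff.2 fun y hy => congrArg Subtype.val
      ((IsCyclic.isMulCommutative (α := N)).is_comm.comm ⟨y, hy⟩ ⟨x, hx⟩)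
  have hD : ⁅commutator G, commutator G⁆ ≤ K := by
    refine Subgroup.commutator_le.2 fun a ha b hb => ?_
    obtain ⟨n₁, hn₁, d₁, hd₁, rfl⟩ := hK.exists_mul_eq_of_le hNC (hC ha)
    obtain ⟨n₂, hn₂, d₂, hd₂, rfl⟩ := hK.exists_mul_eq_of_le hNC (hC hb)
    have hc {n d : G} (hn : n ∈ N) (hd : d ∈ Subgroup.centralizer N) : n * d = d * n :=
      Subgroup.mem_centralizer_iff.1 hd n hn
    have e₁ : n₁ * d₁ * (n₂ * d₂) = d₁ * d₂ * (n₁ * n₂) := by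
      rw [hc hn₁ hd₁.2, hc hn₂ hd₂.2, mul_assoc, ← mul_assoc n₁, hc hn₁ hd₂.2]
      group
    have e₂ : n₂ * d₂ * (n₁ * d₁) = d₂ * d₁ * (n₁ * n₂) := by
      rw [hc hn₁ hd₁.2, hc hn₂ hd₂.2, mul_assoc, ← mul_assoc n₂, hc hn₂ hd₁.2,
        hc hn₁ (hNC hn₂)]
      group
    have e : ⁅n₁ * d₁, n₂ * d₂⁆ = ⁅d₁, d₂⁆ := by
      rw [commutatorElement_def, mul_assoc, ← mul_inv_rev, e₁, e₂, commutatorElement_def]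
      group
    rw [e]
    exact K.mul_mem (K.mul_mem (K.mul_mem hd₁.1 hd₂.1) (K.inv_mem hd₁.1)) (K.inv_mem hd₂.1)
  exact (Subgroup.eq_bot_iff_forall _).2 fun x hx => hK.eq_one (hN hx) (hD hx)

/-- The complement `K` of a subgroup whose order is the least prime divisor of `|G|` has that prime as
its index and so is normal. One of `K'`, `K` and `G` is then the abelian subgroup sought. -/
theorem exists_abelian_normal_of_isCGroup {G : Type*} [Group G] [Finite G] [Nontrivial G]
    (hG : IsCGroup G)
    (ih : ∀ K : Subgroup G, K ≠ ⊤ → ⁅commutator K, commutator K⁆ = ⊥) :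
    ∃ M : Subgroup G, M.Normal ∧ M ≠ ⊥ ∧ ∀ a ∈ M, ∀ b ∈ M, a * b = b * a := by
  have h1 : Nat.card G ≠ 1 := Finite.one_lt_card.ne'
  have hp := Nat.minFac_prime h1
  have := Fact.mk hp
  obtain ⟨x, hx⟩ := exists_prime_orderOf_dvd_card' (G := G) _ (Nat.minFac_dvd (Nat.card G))
  obtain ⟨K, hK⟩ := hG (Subgroup.zpowers x)
  have hKi : K.index = (Nat.card G).minFac := by
    rw [hK.isComplement'.index_eq_card, Nat.card_zpowers, hx]
  have hKn : K.Normal := Subgroup.normal_of_index_eq_minFac_card hKi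
  have hKt : K ≠ ⊤ := fun h => hp.one_lt.ne (by rw [← hKi, h, Subgroup.index_top])
  have hK2 : ⁅⁅K, K⁆, ⁅K, K⁆⁆ = ⊥ := by
    have := congrArg (Subgroup.map K.subtype) (ih K hKt)
    rwa [Subgroup.map_commutator, Subgroup.map_subtype_commutator, Subgroup.map_bot] at this
  have key {M : Subgroup G} (h : ⁅M, M⁆ = ⊥) : ∀ a ∈ M, ∀ b ∈ M, a * b = b * a := fun a ha b hb =>
    commutatorElement_eq_one_iff_mul_comm.1
      (Subgroup.mem_bot.1 (h ▸ Subgroup.commutator_mem_commutator ha hb))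
  by_cases hK1 : ⁅K, K⁆ = ⊥
  · by_cases hK0 : K = ⊥
    · refine ⟨⊤, inferInstance, top_ne_bot, fun a _ b _ => ?_⟩
      have : IsCyclic G := isCyclic_of_prime_card (p := (Nat.card G).minFac) (by
        rw [← hKi, hK0, Subgroup.index_bot])
      exact (IsCyclic.isMulCommutative (α := G)).is_comm.comm a b
    · exact ⟨K, hKn, hK0, key hK1⟩
  · exact ⟨⁅K, K⁆, inferInstance, hK1, key hK2⟩

theorem IsCGroup.commutator_commutator_eq_bot.{u} {G : Type u} [Group G] [Finite G]
    (hG : IsCGroup G) : ⁅commutator G, commutator G⁆ = ⊥ := by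
  induction hn : Nat.card G using Nat.strong_induction_on generalizing G with
  | _ n ih =>
  subst hn
  rcases subsingleton_or_nontrivial G with h | h
  · exact Subsingleton.elim _ _
  obtain ⟨M, hMn, hM0, hM⟩ := exists_abelian_normal_of_isCGroup hG fun K hK =>
    ih _ (lt_of_le_of_ne (Subgroup.card_le_card_group K)
      (mt (Subgroup.eq_top_of_card_eq K) hK)) (hG.subgroup K) rfl
  have hMS := le_primeSocle_of_complemented hM (fun a _ => isOfFinOrder_of_finite a)
    fun H _ => hG H
  obtain ⟨N, hNn, -, hp⟩ : {P : Subgroup G | P.Normal ∧ P ≤ M ∧ (Nat.card P).Prime}.Nonempty := by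
    by_contra hne
    rw [Set.not_nonempty_iff_eq_empty] at hne
    rw [primeSocle, hne, sSup_empty] at hMS
    exact hM0 (le_bot_iff.1 hMS)
  obtain ⟨K, hK⟩ := hG N
  refine commutator_commutator_eq_bot_of_quotient hp hK (ih _ ?_ (hG.quotient N) rfl)
  rw [N.card_eq_card_quotient_mul_card_subgroup]
  exact lt_mul_of_one_lt_right Nat.card_pos hp.one_lt

/-! ### Elements with centralizers of finite index -/

section FiniteClass

open Subgroup

variable {G : Type*} [Group G]

/-- The subgroup of elements whose centralizer has finite index, that is, whose conjugacy class is
finite. -/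
def finiteClassSubgroup (G : Type*) [Group G] : Subgroup G where
  carrier := {a | (centralizer {a}).FiniteIndex}
  one_mem' := by
    have : centralizer {(1 : G)} = ⊤ := by
      ext; simp [mem_centralizer_singleton_iff]
    rw [Set.mem_ofPred_eq, this]
    infer_instance
  mul_mem' {a b} (ha : (centralizer {a}).FiniteIndex) (hb : (centralizer {b}).FiniteIndex) := by
    refine finiteIndex_of_le (H := centralizer {a} ⊓ centralizer {b}) fun g hg => ?_
    obtain ⟨h₁, h₂⟩ := hg
    replace h₁ := mem_centralizer_singleton_iff.1 h₁
    replace h₂ := mem_centralizer_singleton_iff.1 h₂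
    exact mem_centralizer_singleton_iff.2 (Commute.mul_right h₁ h₂)
  inv_mem' {a} (ha : (centralizer {a}).FiniteIndex) := by
    refine finiteIndex_of_le (H := centralizer {a}) fun g hg => ?_
    rw [mem_centralizer_singleton_iff] at hg ⊢
    exact Commute.inv_right hg

theorem mem_finiteClassSubgroup {a : G} :
    a ∈ finiteClassSubgroup G ↔ (centralizer {a}).FiniteIndex :=
  Iff.rfl

theorem le_finiteClassSubgroup_of_finite (P : Subgroup G) [P.Normal] [Finite P] :
    P ≤ finiteClassSubgroup G := fun a ha => by
  have : Finite (MulAut P) := Finite.of_injective (fun e : MulAut P => (e : P → P))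
    DFunLike.coe_injective
  refine mem_finiteClassSubgroup.2 (finiteIndex_of_le (H := (MulAut.conjNormal (H := P)).ker)
    fun g hg => mem_centralizer_singleton_iff.2 ?_)
  have hga : g * a * g⁻¹ = a := by
    rw [← MulAut.conjNormal_apply g (⟨a, ha⟩ : P), MonoidHom.mem_ker.1 hg, MulAut.one_apply]
  exact mul_inv_eq_iff_eq_mul.1 hga

theorem primeSocle_le_finiteClassSubgroup (A : Subgroup G) :
    primeSocle A ≤ finiteClassSubgroup G :=
  sSup_le fun P ⟨_, _, hp⟩ =>
    have := Nat.finite_of_card_ne_zero hp.ne_zero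
    le_finiteClassSubgroup_of_finite P

theorem finite_range_conj {a : G} (ha : a ∈ finiteClassSubgroup G) :
    (Set.range fun g : G => g * a * g⁻¹).Finite := by
  have := mem_finiteClassSubgroup.1 ha
  refine (Set.finite_range fun q : G ⧸ centralizer {a} => q.out * a * q.out⁻¹).subset ?_
  rintro _ ⟨g, rfl⟩
  refine ⟨(g : G ⧸ centralizer {a}), ?_⟩
  obtain ⟨⟨c, hc⟩, h⟩ := QuotientGroup.mk_out_eq_mul (centralizer {a}) g
  rw [mem_centralizer_singleton_iff] at hc
  simp only [h]
  calc g * c * a * (g * c)⁻¹ = g * (c * a) * c⁻¹ * g⁻¹ := by group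
    _ = g * a * g⁻¹ := by rw [hc]; group

/-- The normal closure of an element is generated by its finitely many conjugates, hence is a
finitely generated abelian torsion group. -/
theorem finite_normalClosure {A : Subgroup G} [hAn : A.Normal]
    (hA : ∀ a ∈ A, ∀ b ∈ A, a * b = b * a) (ht : ∀ a ∈ A, IsOfFinOrder a) {a : G} (ha : a ∈ A)
    (hf : a ∈ finiteClassSubgroup G) : Finite (normalClosure {a}) := by
  have hle : normalClosure {a} ≤ A := normalClosure_le_normal (Set.singleton_subset_iff.2 ha)
  let _ : CommGroup (normalClosure {a}) :=
    { (inferInstance : Group (normalClosure {a})) with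
      mul_comm := fun x y => Subtype.ext (hA x (hle x.2) y (hle y.2)) }
  have : Group.FG (normalClosure {a}) := by
    refine (Group.fg_iff_subgroup_fg _).2 ⟨(finite_range_conj hf).toFinset, ?_⟩
    rw [normalClosure, Group.conjugatesOfSet, Set.biUnion_singleton]
    congr 1
    ext x
    simp [conjugatesOf, isConj_iff]
  exact CommGroup.finite_of_fg_isMulTorsion _ fun x =>
    Submonoid.isOfFinOrder_coe.1 (ht x (hle x.2))

end FiniteClass

section Baire

open Subgroup Topology

variable {G : Type*} [Group G] [TopologicalSpace G] [IsTopologicalGroup G] [CompactSpace G]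
  [TotallyDisconnectedSpace G]

/-- The open normal subgroup `V` can be chosen to separate the finitely many conjugates of `u`. -/
theorem exists_openNormalSubgroup_centralizer_le {u : G} (hu : u ∈ finiteClassSubgroup G) :
    ∃ V : OpenNormalSubgroup G, ∀ w, u⁻¹ * w ∈ V → centralizer {w} ≤ centralizer {u} := by
  have hopen : IsOpen ((fun x => u⁻¹ * x) '' ((Set.range fun g : G => g * u * g⁻¹) \ {u}))ᶜ :=
    (((finite_range_conj hu).subset Set.sdiff_subset).image _).isClosed.isOpen_compl
  obtain ⟨V, hV⟩ := ProfiniteGrp.exist_openNormalSubgroup_sub_open_nhds_of_one hopen (by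
    rintro ⟨x, ⟨-, hx⟩, h⟩
    exact hx (inv_mul_eq_one.1 h).symm)
  refine ⟨V, fun w hw g hg => ?_⟩
  rw [mem_centralizer_singleton_iff] at hg ⊢
  by_contra hgu
  have hne : g * u * g⁻¹ ≠ u := fun h => hgu (mul_inv_eq_iff_eq_mul.1 h)
  have hmem : u⁻¹ * (g * u * g⁻¹) ∈ V := by
    have h₁ : g * (u⁻¹ * w)⁻¹ * g⁻¹ ∈ V := V.isNormal'.conj_mem _ (inv_mem hw) g
    have h₂ : u⁻¹ * (g * u * g⁻¹) = u⁻¹ * w * (g * (u⁻¹ * w)⁻¹ * g⁻¹) := by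
      have hw' : w = g * w * g⁻¹ := (mul_inv_eq_iff_eq_mul.2 hg).symm
      calc u⁻¹ * (g * u * g⁻¹) = u⁻¹ * (g * w * g⁻¹) * (g * w⁻¹ * u * g⁻¹) := by group
        _ = _ := by rw [← hw']; group
    rw [h₂]
    exact mul_mem hw h₁
  exact hV hmem ⟨_, ⟨⟨g, rfl⟩, hne⟩, rfl⟩

/-- By Baire, the index of `C(a)` is bounded on a nonempty open subset of `A`. Let it be maximal at
`u` in this subset. For `v ∈ A` close to `1` then `C(u v) = C(u)`, so `C(u)` centralizes `v`. Thus a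
subgroup of finite index centralizes an open subgroup of `A`, and finitely many further elements
generate `A` modulo this open subgroup. -/
theorem finiteIndex_centralizer_of_le_finiteClassSubgroup {A : Subgroup G}
    (hA : IsClosed (A : Set G)) (h : A ≤ finiteClassSubgroup G) :
    (centralizer (A : Set G)).FiniteIndex := by
  have : CompactSpace A := isCompact_iff_compactSpace.1 hA.isCompact
  have hfi (a : A) : (centralizer {(a : G)}).FiniteIndex := h a.2
  let f : A → ℕ := fun a => (centralizer {(a : G)}).index
  have hclosed (n : ℕ) : IsClosed {a : A | f a ≤ n} := by
    refine isOpen_compl_iff.1 (isOpen_iff_mem_nhds.2 fun u hu => ?_)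
    obtain ⟨V, hV⟩ := exists_openNormalSubgroup_centralizer_le (h u.2)
    have hVu : {w : A | (u : G)⁻¹ * w ∈ V} ∈ 𝓝 u :=
      (V.isOpen'.preimage (by fun_prop)).mem_nhds (by simp [one_mem])
    filter_upwards [hVu] with w hw
    have hfw := hfi w
    have : f u ≤ f w := index_antitone (hV w hw)
    simp only [Set.mem_compl_iff, Set.mem_ofPred_eq, not_le] at hu ⊢
    omega
  obtain ⟨n, hn⟩ := nonempty_interior_of_iUnion_of_closed hclosed
    (Set.eq_univ_of_forall fun a => Set.mem_iUnion.2 ⟨f a, by simp⟩)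
  set W := interior {a : A | f a ≤ n}
  obtain ⟨u, hu, hmax⟩ : ∃ u ∈ W, ∀ w ∈ W, f w ≤ f u := by
    have hbdd : BddAbove (f '' W) := ⟨n, by
      rintro _ ⟨w, hw, rfl⟩
      exact (interior_subset hw : w ∈ {a : A | f a ≤ n})⟩
    obtain ⟨u, hu, hfu⟩ := Nat.sSup_mem (hn.image f) hbdd
    exact ⟨u, hu, fun w hw => hfu ▸ le_csSup hbdd ⟨w, hw, rfl⟩⟩
  obtain ⟨V₁, hV₁⟩ := exists_openNormalSubgroup_centralizer_le (h u.2)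
  obtain ⟨O, hO, hOW⟩ : ∃ O, IsOpen O ∧ (Subtype.val : A → G) ⁻¹' O = W :=
    isOpen_induced_iff.1 isOpen_interior
  have huO : (u : G) ∈ O := by
    rw [← hOW] at hu
    exact hu
  obtain ⟨V, hV⟩ := ProfiniteGrp.exist_openNormalSubgroup_sub_open_nhds_of_one
    (V₁.isOpen'.inter (hO.preimage (continuous_const_mul (u : G))))
    ⟨V₁.one_mem', by simpa using huO⟩
  have hcent (v : G) (hvA : v ∈ A) (hvV : v ∈ V) : centralizer {(u : G)} ≤ centralizer {v} := by
    obtain ⟨h₁, h₂⟩ := hV hvV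
    have hle : centralizer {(u * v : G)} ≤ centralizer {(u : G)} :=
      hV₁ _ (by rw [inv_mul_cancel_left]; exact h₁)
    have huv : u * ⟨v, hvA⟩ ∈ W := by
      rw [← hOW]
      exact h₂
    have heq : centralizer {(u * v : G)} = centralizer {(u : G)} := by
      by_contra hne
      have := hfi (u * ⟨v, hvA⟩)
      have hlt := index_strictAnti (lt_of_le_of_ne hle hne)
      exact (hmax _ huv).not_gt hlt
    intro g hg
    have hg' := heq ▸ hg
    rw [mem_centralizer_singleton_iff] at hg hg' ⊢
    have := Commute.mul_right (Commute.inv_right hg : Commute g (u : G)⁻¹) hg'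
    rwa [inv_mul_cancel_left] at this
  have : Finite (G ⧸ V.toSubgroup) := quotient_finite_of_isOpen _ V.isOpen'
  obtain ⟨F, hFA, hF⟩ := Set.exists_subset_bijOn (A : Set G)
    (QuotientGroup.mk : G → G ⧸ V.toSubgroup)
  have hFfin : Finite F := Finite.of_injective (fun x : F => (x : G ⧸ V.toSubgroup))
    fun x y hxy => Subtype.ext (hF.injOn x.2 y.2 hxy)
  have hFi := finiteIndex_iInf (f := fun x : F => centralizer {(x : G)}) fun x => h (hFA x.2)
  have hui := hfi u
  refine finiteIndex_of_le (H := centralizer {(u : G)} ⊓ ⨅ x : F, centralizer {(x : G)}) ?_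
  rintro g ⟨hgu, hgF⟩
  refine mem_centralizer_iff.2 fun a ha => ?_
  obtain ⟨x, hx, hxa⟩ := hF.surjOn ⟨a, ha, rfl⟩
  have hgx := mem_centralizer_singleton_iff.1 (mem_iInf.1 hgF ⟨x, hx⟩)
  have hgv := mem_centralizer_singleton_iff.1 (hcent (x⁻¹ * a)
    (A.mul_mem (A.inv_mem (hFA hx)) ha) (QuotientGroup.eq.1 hxa) hgu)
  have := Commute.mul_right hgx hgv
  rw [mul_inv_cancel_left] at this
  exact this.eq.symm

end Baire

/-! ### Profinite groups with complemented closed subgroups -/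

namespace IsProfiniteCGroup

variable {G : Type*} [Group G] [TopologicalSpace G]

theorem subgroup (hG : IsProfiniteCGroup G) {L : Subgroup G} (hL : IsClosed (L : Set G)) :
    IsProfiniteCGroup L := fun H hH => by
  have hH' : IsClosed (H.map L.subtype : Set G) := by
    rw [Subgroup.coe_map]
    exact hL.isClosedEmbedding_subtypeVal.isClosedMap _ hH
  obtain ⟨K, hKc, hK⟩ := hG _ hH'
  have := hK.subgroupOf (Subgroup.map_subtype_le H)
  rw [← Subgroup.comap_subtype, Subgroup.comap_map_eq_self_of_injective L.subtype_injective] at this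
  exact ⟨_, hKc.preimage continuous_subtype_val, this⟩

theorem isCGroup_quotient [IsTopologicalGroup G] (hG : IsProfiniteCGroup G) (N : Subgroup G)
    [N.Normal] (hN : IsOpen (N : Set G)) : IsCGroup (G ⧸ N) := fun H =>
  have hc : IsClosed (H.comap (QuotientGroup.mk' N) : Set G) :=
    Subgroup.isClosed_of_isOpen _
      (Subgroup.isOpen_mono (H₁ := N) (fun x hx => Subgroup.mem_comap.2 (by
        rw [QuotientGroup.mk'_apply, (QuotientGroup.eq_one_iff x).2 hx]
        exact H.one_mem)) hN)
  let ⟨_, _, hK⟩ := hG _ hc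
  ⟨_, hK.map_mk'⟩

theorem le_primeSocle_of_finite [T2Space G] (hG : IsProfiniteCGroup G) (M : Subgroup G) [M.Normal]
    [Finite M] (hM : ∀ a ∈ M, ∀ b ∈ M, a * b = b * a) : M ≤ primeSocle M :=
  le_primeSocle_of_complemented hM
    (fun a ha => Submonoid.isOfFinOrder_coe.2 (isOfFinOrder_of_finite (⟨a, ha⟩ : M)))
    fun H hH =>
      let ⟨K, _, hK⟩ := hG H ((Set.toFinite (M : Set G)).subset hH).isClosed
      ⟨K, hK⟩

/-- Each cyclic subgroup is finite, hence closed together with all of its subgroups, and therefore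
generated by elements of prime order. -/
theorem isCGroup_of_comm [T2Space G] (hG : IsProfiniteCGroup G) (ht : IsMulTorsion G)
    (hc : ∀ a b : G, a * b = b * a) : IsCGroup G := by
  refine isCGroup_of_top_le_primeSocle fun a _ => ?_
  have hn : (Subgroup.zpowers a).Normal := ⟨fun n hn g => by rwa [hc g n, mul_inv_cancel_right]⟩
  have hfin : Finite (Subgroup.zpowers a) := finite_zpowers.2 (ht a)
  exact primeSocle_mono le_top
    (hG.le_primeSocle_of_finite _ (fun x _ y _ => hc x y) (Subgroup.mem_zpowers a))

variable [IsTopologicalGroup G] [CompactSpace G] [TotallyDisconnectedSpace G]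

/-- All finite continuous quotients of the group are metabelian, and they separate its points. -/
theorem commutator_commutator_eq_bot (hG : IsProfiniteCGroup G) :
    ⁅commutator G, commutator G⁆ = ⊥ := by
  refine (Subgroup.eq_bot_iff_forall _).2 fun x hx => ?_
  by_contra hx1
  obtain ⟨V, hV⟩ := ProfiniteGrp.exist_openNormalSubgroup_sub_open_nhds_of_one
    (isOpen_compl_singleton (x := x)) (fun h : (1 : G) = x => hx1 h.symm)
  have : Finite (G ⧸ V.toSubgroup) := Subgroup.quotient_finite_of_isOpen _ V.isOpen'
  have h := (hG.isCGroup_quotient V.toSubgroup V.isOpen').commutator_commutator_eq_bot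
  have hmem := Subgroup.mem_map_of_mem (QuotientGroup.mk' V.toSubgroup) hx
  rw [Subgroup.map_commutator, commutator_def, Subgroup.map_commutator,
    Subgroup.map_top_of_surjective _ (QuotientGroup.mk'_surjective _), ← commutator_def, h] at hmem
  exact hV ((QuotientGroup.eq_one_iff x).1 (Subgroup.mem_bot.1 hmem)) rfl

theorem closure_commutator_comm (hG : IsProfiniteCGroup G) :
    ∀ a ∈ (commutator G).topologicalClosure, ∀ b ∈ (commutator G).topologicalClosure,
      a * b = b * a := fun a ha b hb => by
  let _ := (commutator G).commGroupTopologicalClosure fun x y => Subtype.ext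
    (commutatorElement_eq_one_iff_mul_comm.1 (Subgroup.mem_bot.1
      (hG.commutator_commutator_eq_bot ▸ Subgroup.commutator_mem_commutator x.2 y.2)))
  exact congrArg Subtype.val
    (mul_comm (⟨a, ha⟩ : (commutator G).topologicalClosure) ⟨b, hb⟩)

/-- With `A` the closure of `G'`, all elements of `A` have finite conjugacy classes, so `A` has a
centralizer of finite index. As a complement `B` of `A` is abelian, `C(A) = A (C(A) ∩ B)` is
contained in `A Z(G)`. -/
theorem finiteIndex_of_isCGroup (hG : IsProfiniteCGroup G) (hC : IsCGroup G) :
    (Subgroup.center G ⊔ (commutator G).topologicalClosure).FiniteIndex := by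
  have hcomm := hG.closure_commutator_comm
  have hAn := (commutator G).is_normal_topologicalClosure
  have hAc := (commutator G).isClosed_topologicalClosure
  have hle := (commutator G).le_topologicalClosure
  set A := (commutator G).topologicalClosure
  have hA : A ≤ primeSocle A :=
    le_primeSocle_of_complemented hcomm (fun a _ => hC.isMulTorsion a) fun H _ => hC H
  have hfin := finiteIndex_centralizer_of_le_finiteClassSubgroup hAc
    (hA.trans (primeSocle_le_finiteClassSubgroup A))
  obtain ⟨B, hB⟩ := hC A
  refine Subgroup.finiteIndex_of_le (H := Subgroup.centralizer A) fun c hc => ?_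
  obtain ⟨a, ha, b, hb, rfl⟩ := hB.exists_mul_eq_of_le
    (fun x hx => Subgroup.mem_centralizer_iff.2 fun y hy => hcomm y hy x hx) hc
  refine mul_mem (Subgroup.mem_sup_right ha)
    (Subgroup.mem_sup_left (Subgroup.mem_center_iff.2 fun g => ?_))
  obtain ⟨a', ha', b', hb', rfl⟩ := hB.exists_mul_eq g
  have hbb' : Commute b b' := commutatorElement_eq_one_iff_mul_comm.1 (hB.eq_one
    (hle (Subgroup.commutator_mem_commutator (Subgroup.mem_top _) (Subgroup.mem_top _)))
    (B.mul_mem (B.mul_mem (B.mul_mem hb.1 hb') (B.inv_mem hb.1)) (B.inv_mem hb')))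
  exact (Commute.mul_right
    (Subgroup.mem_centralizer_iff.1 hb.2 a' ha').symm hbb').eq.symm

/-- The closure `A` of `G'` is centralized by `Z(G) A`, so the normal closures of its elements are
finite; hence `A` is generated by normal subgroups of prime order. -/
theorem isCGroup_of_finiteIndex (hG : IsProfiniteCGroup G) (ht : IsMulTorsion G)
    (hf : (Subgroup.center G ⊔ (commutator G).topologicalClosure).FiniteIndex) : IsCGroup G := by
  have hcomm := hG.closure_commutator_comm
  have hAn := (commutator G).is_normal_topologicalClosure
  have hAc := (commutator G).isClosed_topologicalClosure
  have hle := (commutator G).le_topologicalClosure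
  set A := (commutator G).topologicalClosure
  have hA : A ≤ primeSocle A := by
    intro a ha
    have haf : a ∈ finiteClassSubgroup G :=
      mem_finiteClassSubgroup.2 (Subgroup.finiteIndex_of_le (H := Subgroup.center G ⊔ A)
        (sup_le (Subgroup.center_le_centralizer _) fun x hx =>
          Subgroup.mem_centralizer_singleton_iff.2 (hcomm x hx a ha)))
    have hM : Subgroup.normalClosure {a} ≤ A :=
      Subgroup.normalClosure_le_normal (Set.singleton_subset_iff.2 ha)
    have := finite_normalClosure hcomm (fun a _ => ht a) ha haf
    exact primeSocle_mono hM (hG.le_primeSocle_of_finite _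
      (fun x hx y hy => hcomm x (hM hx) y (hM hy))
      (Subgroup.subset_normalClosure (Set.mem_singleton a)))
  obtain ⟨B, hBc, hB⟩ := hG A hAc
  refine isCGroup_of_le_primeSocle hA hB ((hG.subgroup hBc).isCGroup_of_comm (ht.subgroup B)
    fun x y => Subtype.ext (commutatorElement_eq_one_iff_mul_comm.1 (hB.eq_one
      (hle (Subgroup.commutator_mem_commutator (Subgroup.mem_top _) (Subgroup.mem_top _)))
      (B.mul_mem (B.mul_mem (B.mul_mem x.2 y.2) (B.inv_mem x.2)) (B.inv_mem y.2)))))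

end IsProfiniteCGroup

theorem theoremC {G : Type*} [Group G] [TopologicalSpace G] [IsTopologicalGroup G]
    [CompactSpace G] [TotallyDisconnectedSpace G] (hG : IsProfiniteCGroup G) :
    (IsCGroup G ↔
      (IsMulTorsion G ∧
        (Subgroup.center G ⊔ (commutator G).topologicalClosure).FiniteIndex)) ∧
    ((∀ a b : G, a * b = b * a) → (IsCGroup G ↔ IsMulTorsion G)) :=
  ⟨⟨fun h => ⟨h.isMulTorsion, hG.finiteIndex_of_isCGroup h⟩,
    fun h => hG.isCGroup_of_finiteIndex h.1 h.2⟩,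
    fun hc => ⟨fun h => h.isMulTorsion, fun ht => hG.isCGroup_of_comm ht hc⟩⟩
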